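/- **Conventions.** Let $A$ be a C*-algebra (not necessarily unital) and $\pi:A\to\mathcal B(\mathcal H)$ a faithful representation. For $\Omega\subset A$ and $\delta>0$, let $\mathrm{CPA}(\pi,\Omega,\delta)$ be the collection of triples $(\phi,\psi,B)$ in which $B$ is a nonzero finite-dimensional C*-algebra and $\phi:A\to B$, $\psi:B\to\mathcal B(\mathcal H)$ are completely positive contractive linear maps with $\|\psi(\phi(x))-\pi(x)\|<\delta$ for all $x\in\Omega$. The algebra $A$ is *exact* (equivalently, nuclearly embeddable) if for some faithful representation $\pi$ this collection is nonempty for all finite $\Omega\subset A$ and all $\delta>0$. Let $\mathrm{rcp}(\Omega,\delta)$ be the infimum over $\mathrm{CPA}(\pi,\Omega,\delta)$ of $\mathrm{rank}\,B$, the dimension of a maximal commutative C*-subalgebra of $B$ (for exact $A$ this infimum does not depend on $\pi$). For an automorphism $\alpha$ of $A$ put $$ht(\alpha,\Omega,\delta)=\limsup_{n\to\infty}\frac1n\log\mathrm{rcp}\bigl(\Omega\cup\alpha\Omega\cup\dots\cup\alpha^{n-1}\Omega,\ \delta\bigr),\qquad ht(\alpha)=\sup_{\Omega}\,\sup_{\delta>0}\,ht(\alpha,\Omega,\delta),$$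 where the supremum is over finite $\Omega\subset A$. A linear isomorphism $\Gamma$ between Banach spaces is a *$D$-isomorphism* if $\|\Gamma\|\,\|\Gamma^{-1}\|\le D$. All spaces are over $\mathbb C$. **Proposition.** There is a universal constant $a>0$ with the following property. Let $\alpha$ be an automorphism of an exact C*-algebra $A$, let $\pi$ be any faithful representation of $A$ (used to compute $\mathrm{rcp}$), let $\Omega\subset A$ be finite, let $D\ge1$, and for each $n\in\mathbb N$ let $I_n\subset\{0,\dots,n-1\}\times\Omega$ be such that some map from the standard basis of $\ell_1^{I_n}$ to $S_n=\{\alpha^k(x):(k,x)\in I_n\}$ extends linearly to a $D$-isomorphism from $\ell_1^{I_n}$ onto the linear span of $S_n$. Suppose that $\limsup_{n\to\infty}|I_n|/n>0$. Then: 1. $ht(\alpha)>0$. 2. Let $\rho>0$ be such that for every $n$ with $I_n\ne\emptyset$ there is some $(k,x)\in I_n$ with $\|x\|\ge\rho$. Then for every real $\mu$ with $0<\mu\le\limsup_{n\to\infty}|I_n|/n$ and every $\delta$ with $0<\delta<\rho D^{-1}$, $$ht(\alpha,\Omega,\delta)\ \ge\ \mu\,a^{-1}D^{-2}\Bigl(1-\frac{D\delta}{\rho}\Bigr)^2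 .$$ In particular, when $\rho=1$ is admissible, $ht(\alpha,\Omega,\delta)\ge\mu a^{-1}D^{-2}(1-D\delta)^2$ for all $0<\delta<D^{-1}$. -/

import Mathlib

open Filter
open scoped CStarAlgebra

universe u v

section VoiculescuBrown

variable {A : Type u} [NonUnitalCStarAlgebra A] [PartialOrder A] [StarOrderedRing A]
variable {H : Type v} [NormedAddCommGroup H] [InnerProductSpace ℂ H] [CompleteSpace H]

/-- The collection `CPA(π, Ω, δ)` of triples `(φ, ψ, B)`: `B` is a (nonzero) finite-dimensional
C*-algebra, `φ : A → B` and `ψ : B → B(H)` are completely positive contractive linear maps, and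
`‖ψ (φ x) - π x‖ < δ` for all `x ∈ Ω`.  The order on `B` is the usual one, since `StarOrderedRing`
determines it.  (Every finite-dimensional C*-algebra is isomorphic to one in `Type`.) -/
structure CPA (π : A →⋆ₙₐ[ℂ] (H →L[ℂ] H)) (Ω : Set A) (δ : ℝ) where
  B : Type
  [instCStar : CStarAlgebra B]
  [instOrder : PartialOrder B]
  [instStarOrdered : StarOrderedRing B]
  [instFinite : FiniteDimensional ℂ B]
  [instNontrivial : Nontrivial B]
  φ : A →CP B
  ψ : B →CP (H →L[ℂ] H)
  φ_contractive : ∀ x, ‖φ x‖ ≤ ‖x‖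
  ψ_contractive : ∀ b, ‖ψ b‖ ≤ ‖b‖
  approx : ∀ x ∈ Ω, ‖ψ (φ x) - π x‖ < δ

attribute [instance] CPA.instCStar CPA.instOrder CPA.instStarOrdered CPA.instFinite
  CPA.instNontrivial

/-- `C` is a maximal commutative *-subalgebra of `B`.  For finite-dimensional `B` every
*-subalgebra is closed, and a maximal commutative one contains the unit, so these are the maximal
commutative C*-subalgebras of `B`. -/
def IsMaximalCommutative {B : Type} [CStarAlgebra B] (C : StarSubalgebra ℂ B) : Prop :=
  Maximal (fun S : StarSubalgebra ℂ B => ∀ x ∈ S, ∀ y ∈ S, x * y = y * x) C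

/-- `rcp(Ω, δ)`, computed in the representation `π`: the infimum of `rank B` over all
`(φ, ψ, B) ∈ CPA(π, Ω, δ)`, where `rank B` is the dimension of a maximal commutative
C*-subalgebra of `B`.  An empty infimum is `⊤`. -/
noncomputable def rcp (π : A →⋆ₙₐ[ℂ] (H →L[ℂ] H)) (Ω : Set A) (δ : ℝ) : ℕ∞ :=
  ⨅ (T : CPA π Ω δ) (C : StarSubalgebra ℂ T.B) (_ : IsMaximalCommutative C),
    (Module.finrank ℂ C : ℕ∞)

/-- `Ω ∪ αΩ ∪ ⋯ ∪ αⁿ⁻¹Ω`. -/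
def partialOrbit (α : A ≃⋆ₐ[ℂ] A) (Ω : Set A) (n : ℕ) : Set A :=
  ⋃ k : Fin n, (α : A → A)^[(k : ℕ)] '' Ω

/-- `ht(α, Ω, δ) = limsup (1/n) log rcp(Ω ∪ ⋯ ∪ αⁿ⁻¹Ω, δ)`, as an extended real number. -/
noncomputable def htAt (π : A →⋆ₙₐ[ℂ] (H →L[ℂ] H)) (α : A ≃⋆ₐ[ℂ] A) (Ω : Set A) (δ : ℝ) :
    EReal :=
  limsup (fun n : ℕ => ENNReal.log (rcp π (partialOrbit α Ω n) δ : ENNReal) / (n : EReal)) atTop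

/-- `ht(α, Ω) = sup_{δ > 0} ht(α, Ω, δ)`. -/
noncomputable def htOn (π : A →⋆ₙₐ[ℂ] (H →L[ℂ] H)) (α : A ≃⋆ₐ[ℂ] A) (Ω : Set A) : EReal :=
  ⨆ (δ : ℝ) (_ : 0 < δ), htAt π α Ω δ

/-- The Voiculescu-Brown entropy `ht(α) = sup_Ω ht(α, Ω)`, over all finite `Ω ⊂ A`. -/
noncomputable def ht (π : A →⋆ₙₐ[ℂ] (H →L[ℂ] H)) (α : A ≃⋆ₐ[ℂ] A) : EReal :=
  ⨆ Ω : Finset A, htOn π α (Ω : Set A)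

end VoiculescuBrown

/-- Exactness of a C*-algebra in the form of nuclear embeddability: some faithful representation
`π : A → B(H)` is nuclear, that is, on every finite set and up to every `δ > 0` it factors
approximately through a finite-dimensional C*-algebra by completely positive contractions. -/
def IsExactCStarAlgebra (A : Type u) [NonUnitalCStarAlgebra A] [PartialOrder A]
    [StarOrderedRing A] : Prop :=
  ∃ (H : Type u) (_ : NormedAddCommGroup H) (_ : InnerProductSpace ℂ H) (_ : CompleteSpace H)
    (π : A →⋆ₙₐ[ℂ] (H →L[ℂ] H)), Function.Injective π ∧
      ∀ (Ω : Finset A) (δ : ℝ), 0 < δ → Nonempty (CPA π (Ω : Set A) δ)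

/-- A `D`-isomorphism between normed spaces: `‖Γ‖ ‖Γ⁻¹‖ ≤ D`. -/
def IsDIsomorphism {Y Z : Type*} [NormedAddCommGroup Y] [NormedSpace ℂ Y]
    [NormedAddCommGroup Z] [NormedSpace ℂ Z] (D : ℝ) (Γ : Y ≃L[ℂ] Z) : Prop :=
  ‖(Γ : Y →L[ℂ] Z)‖ * ‖(Γ.symm : Z →L[ℂ] Y)‖ ≤ D

open Classical in
/-- Some map from the standard basis of `ℓ₁^ι` to the set `S` extends linearly to a
`D`-isomorphism from `ℓ₁^ι` onto the linear span of `S`. -/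
def IsEll1Basis (ι : Type*) [Fintype ι] {A : Type*} [NonUnitalCStarAlgebra A]
    (D : ℝ) (S : Set A) : Prop :=
  ∃ Γ : PiLp 1 (fun _ : ι => ℂ) ≃L[ℂ] Submodule.span ℂ S,
    (∀ i : ι, (Γ (PiLp.single 1 i 1) : A) ∈ S) ∧ IsDIsomorphism D Γ

/-! The core is a rank estimate: if `n` contractions in a finite-dimensional C*-algebra of rank `r`
have all signed sums of norm at least `c * n`, then `2 * r ^ 2 ≥ exp (n * c ^ 2 / 2)`. Write `X ε =
∑ ε i • x i`. Compressing to the minimal projections of a maximal commutative subalgebra gives `∑ ‖X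
ε‖ ^ (2k) ≤ r ^ 2 * ‖∑ (star (X ε) * X ε) ^ k‖` (`sum_norm_pow_le`). When the right side is
expanded, every word in the `x i` and their adjoints has norm at most 1 and a nonnegative
coefficient, so the scalar case `x i = 1` dominates (`norm_sum_smul_pow_le`). Summing the moments
into a hyperbolic cosine gives `cosh (c ^ 2 * n) ≤ r ^ 2 * cosh c ^ n`, and `cosh c ≤ exp (c ^ 2 /
2)` finishes (`mul_card_le_log_rank`). An ℓ₁ basis has large signed sums, and an approximate
factorization through `B` preserves them up to `n * δ`. Hence `log rcp` grows linearly in `|I n|`.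
-/

/-! ### Minimal projections of a maximal commutative subalgebra. -/

section MaximalCommutative

variable {B : Type} [CStarAlgebra B]

theorem IsMaximalCommutative.mem_of_forall_commute {C : StarSubalgebra ℂ B}
    (hC : IsMaximalCommutative C) {b : B} (hb : IsSelfAdjoint b)
    (hcomm : ∀ c ∈ C, c * b = b * c) : b ∈ C := by
  have hP : ∀ x ∈ StarAlgebra.adjoin ℂ ((C : Set B) ∪ {b}),
      ∀ y ∈ StarAlgebra.adjoin ℂ ((C : Set B) ∪ {b}), x * y = y * x := by
    have key : ∀ x ∈ (C : Set B) ∪ {b}, ∀ y ∈ (C : Set B) ∪ {b}, x * y = y * x := by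
      rintro x (hx | rfl) y (hy | rfl)
      · exact hC.prop x hx y hy
      · exact hcomm x hx
      · exact (hcomm y hy).symm
      · rfl
    have hstar : ∀ y ∈ (C : Set B) ∪ {b}, star y ∈ (C : Set B) ∪ {b} := by
      rintro y (hy | rfl)
      · exact Or.inl (star_mem hy)
      · exact Or.inr hb.star_eq
    have := StarAlgebra.isMulCommutative_adjoin ℂ key
      (fun x hx y hy => key x hx _ (hstar y hy))
    exact fun x hx y hy => setLike_mul_comm hx hy
  have hle : C ≤ StarAlgebra.adjoin ℂ ((C : Set B) ∪ {b}) :=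
    fun x hx => StarAlgebra.subset_adjoin ℂ _ (Or.inl hx)
  exact hC.le_of_ge hP hle (StarAlgebra.subset_adjoin ℂ _ (Or.inr rfl))

/-- A finite-dimensional commutative C*-algebra is spanned by orthogonal projections on which it
acts by scalars, no more of them than its dimension. -/
theorem exists_projections_of_finiteDimensional (C : Type u) [CommCStarAlgebra C]
    [FiniteDimensional ℂ C] :
    ∃ (ι : Type u) (_ : Fintype ι) (p : ι → C) (χ : ι → C → ℂ),
      Fintype.card ι ≤ Module.finrank ℂ C ∧ (∀ i, star (p i) = p i) ∧ (∀ i, p i * p i = p i) ∧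
      ∑ i, p i = 1 ∧ ∀ i c, c * p i = χ i c • p i := by
  classical
  let X : Type u := WeakDual.characterSpace ℂ C
  -- Distinct characters are linearly independent in the dual, so there are at most `finrank ℂ C` of
  -- them; the projections are their indicator functions under the Gelfand transform.
  have hlin : LinearIndependent ℂ (fun f : X => (WeakDual.CharacterSpace.toAlgHom f).toLinearMap) :=
    (linearIndependent_toLinearMap ℂ C ℂ).comp _ WeakDual.CharacterSpace.equivAlgHom.injective
  have : Finite X := hlin.finite
  let _ : Fintype X := Fintype.ofFinite X
  have hcard : Fintype.card X ≤ Module.finrank ℂ C := by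
    have := hlin.fintype_card_le_finrank
    rwa [Module.finrank_linearMap, Module.finrank_self, mul_one] at this
  let e := gelfandStarTransform C
  let d : X → C(X, ℂ) := fun i => ⟨Pi.single i 1, continuous_of_discreteTopology⟩
  have hd : ∀ i j, d i j = if j = i then 1 else 0 := fun i j => by
    simp [d, Pi.single_apply]
  refine ⟨X, inferInstance, fun i => e.symm (d i), fun i c => e c i, hcard, ?_, ?_, ?_, ?_⟩
  · intro i
    rw [← map_star]
    congr 1
    ext j
    simp only [ContinuousMap.star_apply, hd]
    split_ifs <;> simp
  · intro i
    rw [← map_mul]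
    congr 1
    ext j
    simp [hd]
  · rw [← map_sum]
    apply EquivLike.injective e
    rw [e.apply_symm_apply, map_one]
    ext j
    simp only [ContinuousMap.sum_apply, hd, ContinuousMap.one_apply]
    exact Fintype.sum_ite_eq (ι := X) j _
  · intro i c
    apply EquivLike.injective e
    rw [map_mul, map_smul, e.apply_symm_apply]
    ext j
    simp only [ContinuousMap.mul_apply, ContinuousMap.smul_apply, hd, smul_eq_mul]
    split_ifs with h
    · rw [h]
    · simp

/-- The minimal projections of a maximal commutative subalgebra of a finite-dimensional
C*-algebra. -/
theorem IsMaximalCommutative.exists_projections [FiniteDimensional ℂ B] {C : StarSubalgebra ℂ B}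
    (hC : IsMaximalCommutative C) :
    ∃ (ι : Type) (_ : Fintype ι) (p : ι → B),
      Fintype.card ι ≤ Module.finrank ℂ C ∧ (∀ i, star (p i) = p i) ∧ (∀ i, p i * p i = p i) ∧
      ∑ i, p i = 1 ∧ ∀ i b, ∃ c : ℂ, p i * b * p i = c • p i := by
  have hfd : FiniteDimensional ℂ C :=
    FiniteDimensional.finiteDimensional_submodule (Subalgebra.toSubmodule C.toSubalgebra)
  have hcl : IsClosed (C : Set B) :=
    (Subalgebra.toSubmodule C.toSubalgebra).closed_of_finiteDimensional
  let _ : CStarAlgebra C := StarSubalgebra.cstarAlgebra C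
  let _ : CommCStarAlgebra C :=
    { (inferInstance : CStarAlgebra C) with
      mul_comm := fun x y => Subtype.ext (hC.prop x x.2 y y.2) }
  obtain ⟨ι, _, p, χ, hcard, hstar, hidem, hsum, hχ⟩ := exists_projections_of_finiteDimensional C
  have hleft : ∀ i, ∀ c ∈ C, ∃ z : ℂ, c * (p i : B) = z • (p i : B) := fun i c hc =>
    ⟨χ i ⟨c, hc⟩, congrArg Subtype.val (hχ i ⟨c, hc⟩)⟩
  have hstar' : ∀ i, star (p i : B) = p i := fun i => congrArg Subtype.val (hstar i)
  have hidem' : ∀ i, (p i : B) * p i = p i := fun i => congrArg Subtype.val (hidem i)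
  have hself : ∀ i, ∀ b : B, IsSelfAdjoint b → ∃ c : ℂ, (p i : B) * b * p i = c • (p i : B) := by
    intro i b hb
    have hq : IsSelfAdjoint ((p i : B) * b * p i) := by
      rw [IsSelfAdjoint, star_mul, star_mul, hstar', hb.star_eq, mul_assoc]
    -- Each `c ∈ C` acts on `p i` by the same scalar from both sides, so the compression commutes
    -- with `C` and maximality applies.
    have hmem : (p i : B) * b * p i ∈ C := by
      refine hC.mem_of_forall_commute hq fun c hc => ?_
      obtain ⟨z, hz⟩ := hleft i c hc
      have hz' : (p i : B) * c = z • (p i : B) := by rw [← hz, hC.prop _ (p i).2 c hc]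
      rw [mul_assoc _ _ c, hz', ← mul_assoc, ← mul_assoc, hz]
      simp only [smul_mul_assoc, mul_smul_comm]
    obtain ⟨z, hz⟩ := hleft i _ hmem
    refine ⟨z, ?_⟩
    rw [← hz, mul_assoc (_ * b), hidem']
  refine ⟨ι, inferInstance, fun i => p i, hcard, hstar', hidem', ?_, fun i b => ?_⟩
  · have := congrArg (Subtype.val : C → B) hsum
    simpa using this
  · obtain ⟨z, hz⟩ := hself i _ (realPart b).2
    obtain ⟨w, hw⟩ := hself i _ (imaginaryPart b).2
    refine ⟨z + Complex.I * w, ?_⟩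
    conv_lhs => rw [← realPart_add_I_smul_imaginaryPart b]
    rw [mul_add, add_mul, hz, mul_smul_comm, smul_mul_assoc, hw, add_smul, mul_smul]

end MaximalCommutative

/-! ### Moment inequalities in terms of the rank. -/

section Moments

variable {B : Type*} [CStarAlgebra B]

/-- The compression is a scalar multiple of `p`; the C*-identity gives the modulus of the scalar,
and positivity removes its phase. -/
theorem mul_star_mul_self_mul_eq_norm_smul [PartialOrder B] [StarOrderedRing B] {p : B} (hstar : star p = p) (hidem : p * p = p)
    (hp : ∀ b, ∃ c : ℂ, p * b * p = c • p) (z : B) :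
    p * (star z * z) * p = ((‖z * p‖ ^ 2 : ℝ) : ℂ) • p := by
  rcases eq_or_ne p 0 with rfl | h0
  · simp
  obtain ⟨c, hc⟩ := hp (star z * z)
  have hz : star (z * p) * (z * p) = c • p := by
    rw [← hc, star_mul, hstar]; simp only [mul_assoc]
  have hnorm : ‖p‖ = 1 := by
    have h := CStarRing.norm_star_mul_self (x := p)
    rw [hstar, hidem] at h
    have := norm_pos_iff.mpr h0
    nlinarith
  have hpos : 0 ≤ p := by
    have := star_mul_self_nonneg p
    rwa [hstar, hidem] at this
  have hcn : ‖c‖ = ‖z * p‖ ^ 2 := by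
    have h := CStarRing.norm_star_mul_self (x := z * p)
    rw [hz, norm_smul, hnorm, mul_one] at h
    rw [h, sq]
  have hcp : 0 ≤ c • p := hz ▸ star_mul_self_nonneg (z * p)
  have hreal : star c = c := by
    have h : IsSelfAdjoint (c • p) := IsSelfAdjoint.of_nonneg hcp
    have h' : star c • p = c • p := by
      have := h.star_eq
      rwa [star_smul, hstar] at this
    exact smul_left_injective ℂ h0 h'
  obtain ⟨r, rfl⟩ := Complex.conj_eq_iff_real.mp hreal
  have hr : 0 ≤ r := by
    by_contra hneg
    push Not at hneg
    have h1 : 0 ≤ (-r) • p := smul_nonneg (by linarith) hpos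
    have h2 : r • p = 0 := le_antisymm (by simpa using h1) (by simpa using hcp)
    rcases smul_eq_zero.mp h2 with h | h
    · exact hneg.ne h
    · exact h0 h
  rw [hc, ← hcn, Complex.norm_real, Real.norm_of_nonneg hr]

theorem norm_sq_le_card_mul_sum {ι : Type*} [Fintype ι] {p : ι → B} (hsum : ∑ i, p i = 1)
    (z : B) : ‖z‖ ^ 2 ≤ Fintype.card ι * ∑ i, ‖z * p i‖ ^ 2 := by
  have h1 : ‖z‖ ≤ ∑ i, ‖z * p i‖ := by
    conv_lhs => rw [← mul_one z, ← hsum, Finset.mul_sum]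
    exact norm_sum_le _ _
  calc ‖z‖ ^ 2 ≤ (∑ i, ‖z * p i‖) ^ 2 := by gcongr
    _ ≤ _ := by simpa using sq_sum_le_card_mul_sum_sq (s := Finset.univ) (f := fun i => ‖z * p i‖)

/-- Under a minimal projection the squared norms become scalars, so they add exactly inside one
compression: no loss depends on the size of `Ω`. -/
theorem sum_norm_mul_sq_le [PartialOrder B] [StarOrderedRing B] {Ω : Type*} [Fintype Ω] {p : B} (hstar : star p = p)
    (hidem : p * p = p) (hp : ∀ b, ∃ c : ℂ, p * b * p = c • p) (z : Ω → B) :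
    ∑ ω, ‖z ω * p‖ ^ 2 ≤ ‖∑ ω, star (z ω) * z ω‖ := by
  rcases eq_or_ne p 0 with rfl | h0
  · simp
  have hnorm : ‖p‖ = 1 := by
    have h := CStarRing.norm_star_mul_self (x := p)
    rw [hstar, hidem] at h
    have := norm_pos_iff.mpr h0
    nlinarith
  have h : p * (∑ ω, star (z ω) * z ω) * p = ((∑ ω, ‖z ω * p‖ ^ 2 : ℝ) : ℂ) • p := by
    rw [Finset.mul_sum, Finset.sum_mul, Complex.ofReal_sum, Finset.sum_smul]
    exact Finset.sum_congr rfl fun ω _ =>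
      mul_star_mul_self_mul_eq_norm_smul hstar hidem hp (z ω)
  have h' := congrArg norm h
  rw [norm_smul, hnorm, mul_one, Complex.norm_real,
    Real.norm_of_nonneg (Finset.sum_nonneg fun _ _ => sq_nonneg _)] at h'
  rw [← h']
  calc _ ≤ ‖p‖ * ‖∑ ω, star (z ω) * z ω‖ * ‖p‖ :=
        (norm_mul_le _ _).trans (by gcongr; exact norm_mul_le _ _)
    _ = _ := by rw [hnorm]; ring

theorem IsSelfAdjoint.norm_pow_eq {a : B} (ha : IsSelfAdjoint a)
    (n : ℕ) (hn : n ≠ 0) : ‖a ^ n‖ = ‖a‖ ^ n := by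
  rcases eq_or_ne a 0 with rfl | h0
  · simp [hn]
  have hpos := norm_pos_iff.mpr h0
  refine le_antisymm (norm_pow_le' a (Nat.pos_of_ne_zero hn)) ?_
  have h := ha.norm_pow_two_pow n
  obtain ⟨m, hm⟩ := Nat.exists_eq_add_of_lt (Nat.lt_two_pow_self (n := n))
  rw [hm, add_assoc, pow_add, pow_add ‖a‖] at h
  have h2 : ‖a ^ n * a ^ (m + 1)‖ ≤ ‖a ^ n‖ * ‖a‖ ^ (m + 1) :=
    (norm_mul_le _ _).trans (by gcongr; exact norm_pow_le' a m.succ_pos)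
  rw [h] at h2
  exact le_of_mul_le_mul_right h2 (by positivity)

theorem exists_star_mul_self_eq_pow (x : B) (k : ℕ) :
    ∃ z, star z * z = (star x * x) ^ k := by
  rcases Nat.even_or_odd' k with ⟨m, rfl | rfl⟩
  · refine ⟨(star x * x) ^ m, ?_⟩
    rw [star_pow, star_mul, star_star, ← pow_add, two_mul]
  · refine ⟨x * (star x * x) ^ m, ?_⟩
    rw [star_mul, star_pow, star_mul, star_star, mul_assoc, ← mul_assoc (star x) x, ← pow_succ',
      ← pow_add]
    congr 1; omega

/-- Moments of a finite family of operators are controlled by the norm of the averaged power, up to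
the square of the rank. -/
theorem sum_norm_pow_le [PartialOrder B] [StarOrderedRing B] [Nontrivial B]
    {Ω ι : Type*} [Fintype Ω] [Fintype ι] {p : ι → B}
    (hstar : ∀ i, star (p i) = p i) (hidem : ∀ i, p i * p i = p i) (hsum : ∑ i, p i = 1)
    (hp : ∀ i b, ∃ c : ℂ, p i * b * p i = c • p i) (X : Ω → B) (k : ℕ) :
    ∑ ω, ‖X ω‖ ^ (2 * k) ≤
      (Fintype.card ι : ℝ) ^ 2 * ‖∑ ω, (star (X ω) * X ω) ^ k‖ := by
  choose z hz using fun ω => exists_star_mul_self_eq_pow (X ω) k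
  have hnorm : ∀ ω, ‖X ω‖ ^ (2 * k) = ‖z ω‖ ^ 2 := fun ω => by
    rw [sq, ← CStarRing.norm_star_mul_self, hz]
    rcases eq_or_ne k 0 with rfl | hk
    · simp
    · rw [(IsSelfAdjoint.star_mul_self (X ω)).norm_pow_eq k hk, CStarRing.norm_star_mul_self,
        pow_mul, sq]
  -- One factor of the rank comes from Cauchy–Schwarz over the projections, the other from bounding
  -- each projection's share by the full norm.
  calc ∑ ω, ‖X ω‖ ^ (2 * k) ≤ ∑ ω, Fintype.card ι * ∑ i, ‖z ω * p i‖ ^ 2 :=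
        Finset.sum_le_sum fun ω _ => hnorm ω ▸ norm_sq_le_card_mul_sum hsum (z ω)
    _ = Fintype.card ι * ∑ i, ∑ ω, ‖z ω * p i‖ ^ 2 := by
        rw [← Finset.mul_sum, Finset.sum_comm]
    _ ≤ Fintype.card ι * ∑ _i : ι, ‖∑ ω, star (z ω) * z ω‖ := by
        gcongr with i
        exact sum_norm_mul_sq_le (hstar i) (hidem i) (hp i) z
    _ = _ := by
        simp only [hz, Finset.sum_const, Finset.card_univ, nsmul_eq_mul]
        ring

end Moments

/-! ### Domination by scalar random signs. -/

section Signs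

variable {ι Ω : Type*} [Fintype ι] [Fintype Ω] {B : Type*} [CStarAlgebra B] [Nontrivial B]

/-- The weight `m` serves the induction: peeling off one factor `star X * X` leaves words `star (x
i) * x j` of norm at most 1 and moves `w i * w j` into the weight. -/
theorem norm_sum_smul_pow_le {w : Ω → ι → ℝ}
    (hw : ∀ m : Multiset ι, 0 ≤ ∑ ω, (m.map (w ω)).prod) {x : ι → B} (hx : ∀ i, ‖x i‖ ≤ 1)
    (k : ℕ) (m : Multiset ι) :
    ‖∑ ω, (((m.map (w ω)).prod : ℝ) : ℂ) •
        (star (∑ i, (w ω i : ℂ) • x i) * ∑ i, (w ω i : ℂ) • x i) ^ k‖ ≤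
      ∑ ω, (m.map (w ω)).prod * (∑ i, w ω i) ^ (2 * k) := by
  induction k generalizing m with
  | zero =>
    simp only [pow_zero, mul_zero, mul_one, ← Finset.sum_smul, ← Complex.ofReal_sum]
    rw [norm_smul, norm_one, mul_one, Complex.norm_real, Real.norm_of_nonneg (hw m)]
  | succ k ih =>
    have h1 : ∑ ω, (((m.map (w ω)).prod : ℝ) : ℂ) •
        (star (∑ i, (w ω i : ℂ) • x i) * ∑ i, (w ω i : ℂ) • x i) ^ (k + 1) =
        ∑ i, ∑ j, (star (x i) * x j) * ∑ ω, ((((i ::ₘ j ::ₘ m).map (w ω)).prod : ℝ) : ℂ) •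
          (star (∑ i, (w ω i : ℂ) • x i) * ∑ i, (w ω i : ℂ) • x i) ^ k := by
      refine ((Finset.sum_congr rfl fun i _ => (Finset.sum_congr rfl fun j _ =>
        Finset.mul_sum _ _ _).trans Finset.sum_comm).trans
        (Finset.sum_comm.trans (Finset.sum_congr rfl fun ω _ => ?_))).symm
      symm
      rw [pow_succ']
      generalize (star (∑ i, (w ω i : ℂ) • x i) * ∑ i, (w ω i : ℂ) • x i) ^ k = Y
      rw [star_sum, Finset.sum_mul_sum, Finset.sum_mul, Finset.smul_sum]
      refine Finset.sum_congr rfl fun i _ => ?_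
      rw [Finset.sum_mul, Finset.smul_sum]
      refine Finset.sum_congr rfl fun j _ => ?_
      simp only [Multiset.map_cons, Multiset.prod_cons, star_smul, Complex.star_def,
        Complex.conj_ofReal, smul_mul_assoc, mul_smul_comm, smul_smul, Complex.ofReal_mul]
      congr 1
      ring
    have h2 : ∑ ω, (m.map (w ω)).prod * (∑ i, w ω i) ^ (2 * (k + 1)) =
        ∑ i, ∑ j, ∑ ω, ((i ::ₘ j ::ₘ m).map (w ω)).prod * (∑ i, w ω i) ^ (2 * k) := by
      rw [Finset.sum_congr rfl fun i _ => Finset.sum_comm, Finset.sum_comm]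
      refine Finset.sum_congr rfl fun ω _ => ?_
      have : (∑ i, w ω i) ^ (2 * (k + 1)) =
          ∑ i, ∑ j, w ω i * w ω j * (∑ i, w ω i) ^ (2 * k) := by
        rw [mul_add, pow_add, mul_one, mul_comm, sq, Finset.sum_mul_sum, Finset.sum_mul]
        exact Finset.sum_congr rfl fun i _ => Finset.sum_mul _ _ _
      rw [this, Finset.mul_sum]
      refine Finset.sum_congr rfl fun i _ => ?_
      rw [Finset.mul_sum]
      refine Finset.sum_congr rfl fun j _ => ?_
      simp only [Multiset.map_cons, Multiset.prod_cons]
      ring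
    rw [h1, h2]
    refine (norm_sum_le _ _).trans (Finset.sum_le_sum fun i _ => ?_)
    refine (norm_sum_le _ _).trans (Finset.sum_le_sum fun j _ => ?_)
    refine le_trans ?_ (ih (i ::ₘ j ::ₘ m))
    refine (norm_mul_le _ _).trans (mul_le_of_le_one_left (norm_nonneg _) ?_)
    exact (norm_mul_le _ _).trans (mul_le_one₀ (by rw [norm_star]; exact hx i) (norm_nonneg _) (hx j))

/-- The sum factors over coordinates, and each factor `1 + (-1) ^ count` is 0 or 2. -/
theorem sum_signs_prod_nonneg [DecidableEq ι] (m : Multiset ι) :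
    0 ≤ ∑ ε : ι → ℤˣ, (m.map fun i => ((ε i : ℤ) : ℝ)).prod := by
  have h : ∀ ε : ι → ℤˣ, (m.map fun i => ((ε i : ℤ) : ℝ)).prod =
      ∏ i, ((ε i : ℤ) : ℝ) ^ m.count i := fun ε => by
    rw [Finset.prod_multiset_map_count]
    refine Finset.prod_subset (Finset.subset_univ _) fun i _ hi => ?_
    rw [Multiset.count_eq_zero_of_notMem (by simpa using hi), pow_zero]
  simp only [h]
  rw [← Fintype.prod_sum fun i (e : ℤˣ) => ((e : ℤ) : ℝ) ^ m.count i]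
  refine Finset.prod_nonneg fun i _ => ?_
  rcases neg_one_pow_eq_or ℝ (m.count i) with h | h <;> simp [h]

theorem sum_signs_cosh [DecidableEq ι] (t : ℝ) :
    ∑ ε : ι → ℤˣ, Real.cosh (t * ∑ i, ((ε i : ℤ) : ℝ)) =
      2 ^ Fintype.card ι * Real.cosh t ^ Fintype.card ι := by
  have h : ∀ s : ℝ, ∑ ε : ι → ℤˣ, Real.exp (s * ∑ i, ((ε i : ℤ) : ℝ)) =
      (2 * Real.cosh s) ^ Fintype.card ι := fun s => by
    simp only [Finset.mul_sum, Real.exp_sum]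
    rw [← Fintype.prod_sum fun i (e : ℤˣ) => Real.exp (s * ((e : ℤ) : ℝ))]
    have : ∑ e : ℤˣ, Real.exp (s * ((e : ℤ) : ℝ)) = 2 * Real.cosh s := by
      simp [Real.cosh_eq]; ring
    rw [this, Finset.prod_const, Finset.card_univ]
  simp only [Real.cosh_eq (t * _), ← Finset.sum_div, Finset.sum_add_distrib, ← neg_mul, h,
    Real.cosh_neg, mul_pow]
  ring

end Signs

/-! ### The exponential lower bound for the rank. -/

/-- If all signed sums of `n` contractions have norm at least `c * n`, then the rank of the ambient
finite-dimensional C*-algebra is exponentially large in `n`. -/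
theorem mul_card_le_log_rank {B : Type} [CStarAlgebra B] [PartialOrder B] [StarOrderedRing B]
    [FiniteDimensional ℂ B] [Nontrivial B] {C : StarSubalgebra ℂ B} (hC : IsMaximalCommutative C)
    {ι : Type*} [Fintype ι] {x : ι → B} (hx : ∀ i, ‖x i‖ ≤ 1) {c : ℝ} (hc : 0 ≤ c)
    (hlow : ∀ ε : ι → ℤˣ, c * Fintype.card ι ≤ ‖∑ i, (((ε i : ℤ) : ℝ) : ℂ) • x i‖) :
    Fintype.card ι * c ^ 2 / 2 ≤ Real.log (2 * (Module.finrank ℂ C : ℝ) ^ 2) := by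
  classical
  obtain ⟨κ, _, p, hcard, hstar, hidem, hsum, hp⟩ := hC.exists_projections
  set n := Fintype.card ι with hn
  set r := Module.finrank ℂ C with hr
  let w : (ι → ℤˣ) → ι → ℝ := fun ε i => ((ε i : ℤ) : ℝ)
  let X : (ι → ℤˣ) → B := fun ε => ∑ i, (w ε i : ℂ) • x i
  have hmom : ∀ k, ∑ ε, ‖X ε‖ ^ (2 * k) ≤ (r : ℝ) ^ 2 * ∑ ε, (∑ i, w ε i) ^ (2 * k) := fun k => by
    refine (sum_norm_pow_le hstar hidem hsum hp X k).trans ?_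
    have h := norm_sum_smul_pow_le (w := w) sum_signs_prod_nonneg hx k 0
    simp only [Multiset.map_zero, Multiset.prod_zero, Complex.ofReal_one, one_smul, one_mul] at h
    gcongr
  -- The even moments are summed against `t ^ (2k) / (2k)!` with `t = c`, which maximizes the final
  -- exponent `n * (t * c - t ^ 2 / 2)`.
  have hcosh : ∑ ε, Real.cosh (c * ‖X ε‖) ≤ (r : ℝ) ^ 2 * ∑ ε, Real.cosh (c * ∑ i, w ε i) := by
    refine hasSum_le (fun k => ?_) (hasSum_sum fun ε _ => Real.hasSum_cosh (c * ‖X ε‖))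
      ((hasSum_sum fun ε _ => Real.hasSum_cosh (c * ∑ i, w ε i)).mul_left _)
    simp only [mul_pow, mul_div_right_comm, ← Finset.mul_sum]
    calc c ^ (2 * k) / ((2 * k).factorial : ℝ) * ∑ ε, ‖X ε‖ ^ (2 * k)
        ≤ c ^ (2 * k) / ((2 * k).factorial : ℝ) * ((r : ℝ) ^ 2 * ∑ ε, (∑ i, w ε i) ^ (2 * k)) := by
          gcongr; exact hmom k
      _ = _ := by ring
  rw [sum_signs_cosh] at hcosh
  have hlow' : (2 : ℝ) ^ n * Real.cosh (c * (c * n)) ≤ ∑ ε, Real.cosh (c * ‖X ε‖) := by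
    have : ∀ ε ∈ (Finset.univ : Finset (ι → ℤˣ)), Real.cosh (c * (c * n)) ≤
        Real.cosh (c * ‖X ε‖) := fun ε _ => by
      rw [Real.cosh_le_cosh, abs_of_nonneg (by positivity), abs_of_nonneg (by positivity)]
      gcongr
      exact hlow ε
    refine le_trans (le_of_eq ?_) (Finset.card_nsmul_le_sum _ _ _ this)
    simp [hn]
  have hr0 : 0 < r := by
    have : Nonempty κ := by
      by_contra h
      rw [not_nonempty_iff] at h
      simp at hsum
    exact Fintype.card_pos.trans_le hcard
  have h2 : Real.cosh (c * (c * n)) ≤ (r : ℝ) ^ 2 * Real.exp (c ^ 2 / 2) ^ n := by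
    have h3 := hlow'.trans hcosh
    rw [← hn, mul_left_comm ((r : ℝ) ^ 2)] at h3
    refine (le_of_mul_le_mul_left h3 (by positivity)).trans ?_
    gcongr
    exact Real.cosh_le_exp_half_sq c
  rw [Real.le_log_iff_exp_le (by positivity)]
  have h4 : Real.exp (c * (c * n)) ≤ 2 * (r : ℝ) ^ 2 * Real.exp (n * (c ^ 2 / 2)) := by
    rw [Real.exp_nat_mul]
    rw [Real.cosh_eq] at h2
    have := Real.exp_pos (-(c * (c * n)))
    linarith
  rw [show n * c ^ 2 / 2 = c * (c * n) - n * (c ^ 2 / 2) by ring, Real.exp_sub,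
    div_le_iff₀ (Real.exp_pos _)]
  exact h4

/-! ### Signed sums of an ℓ₁ basis. -/

theorem IsEll1Basis.exists_family {ι : Type*} [Fintype ι] {A : Type*} [NonUnitalCStarAlgebra A]
    {D : ℝ} {S : Set A} (h : IsEll1Basis ι D S) {ρ : ℝ} (hρ : 0 < ρ) (hD : 1 ≤ D)
    (hS : S.Finite) (hcard : S.ncard ≤ Fintype.card ι) (hbig : ∃ y ∈ S, ρ ≤ ‖y‖) :
    ∃ (y : ι → A) (K : ℝ), ρ ≤ K ∧ (∀ i, y i ∈ S) ∧ (∀ i, ‖y i‖ ≤ K) ∧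
      ∀ ε : ι → ℤˣ, K / D * Fintype.card ι ≤ ‖∑ i, (((ε i : ℤ) : ℝ) : ℂ) • y i‖ := by
  classical
  obtain ⟨Γ, hΓS, hΓD⟩ := h
  let y : ι → A := fun i => Γ (PiLp.single 1 i 1)
  have hy : ∀ i, ‖y i‖ ≤ ‖(Γ : PiLp 1 (fun _ : ι => ℂ) →L[ℂ] Submodule.span ℂ S)‖ := fun i => by
    have := (Γ : PiLp 1 (fun _ : ι => ℂ) →L[ℂ] Submodule.span ℂ S).le_opNorm (PiLp.single 1 i 1)
    rwa [PiLp.norm_single, norm_one, mul_one] at this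
  have hinj : Function.Injective y := by
    intro i j hij
    have h1 := Γ.injective (Subtype.ext hij)
    by_contra hne
    have := congrArg (fun f : PiLp 1 (fun _ : ι => ℂ) => f i) h1
    simp [hne] at this
  -- By counting, the injective family exhausts `S`; hence the element of norm at least `ρ` is some
  -- `y i`, and `ρ ≤ ‖Γ‖`.
  have hrange : Set.range y = S := by
    refine Set.eq_of_subset_of_ncard_le ?_ ?_ hS
    · rintro _ ⟨i, rfl⟩
      exact hΓS i
    · rw [← Set.image_univ, Set.ncard_image_of_injective _ hinj, Set.ncard_univ,
        Nat.card_eq_fintype_card]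
      exact hcard
  have hK : ρ ≤ ‖(Γ : PiLp 1 (fun _ : ι => ℂ) →L[ℂ] Submodule.span ℂ S)‖ := by
    obtain ⟨z, hz, hρz⟩ := hbig
    rw [← hrange] at hz
    obtain ⟨i, rfl⟩ := hz
    exact hρz.trans (hy i)
  refine ⟨y, _, hK, hΓS, hy, fun ε => ?_⟩
  set K := ‖(Γ : PiLp 1 (fun _ : ι => ℂ) →L[ℂ] Submodule.span ℂ S)‖
  let f : PiLp 1 (fun _ : ι => ℂ) := ∑ i, (((ε i : ℤ) : ℝ) : ℂ) • PiLp.single 1 i 1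
  have hf : ∀ j, f j = (((ε j : ℤ) : ℝ) : ℂ) := fun j => by
    simp [f, WithLp.ofLp_sum, Finset.sum_apply, Pi.single_apply]
  have hfn : ‖f‖ = Fintype.card ι := by
    rw [PiLp.norm_eq_of_L1]
    have : ∀ j, ‖f j‖ = 1 := fun j => by
      rw [hf]
      rcases Int.units_eq_one_or (ε j) with h | h <;> simp [h]
    simp [this]
  have hΓf : ((Γ f : Submodule.span ℂ S) : A) = ∑ i, (((ε i : ℤ) : ℝ) : ℂ) • y i := by
    simp [f, y, map_sum]
  have h1 := (Γ.symm : Submodule.span ℂ S →L[ℂ] PiLp 1 (fun _ : ι => ℂ)).le_opNorm (Γ f)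
  rw [ContinuousLinearEquiv.coe_coe, Γ.symm_apply_apply, hfn] at h1
  have h2 : ‖Γ f‖ = ‖∑ i, (((ε i : ℤ) : ℝ) : ℂ) • y i‖ := by rw [← hΓf]; rfl
  rw [h2] at h1
  have hDpos : 0 < D := by linarith
  have hKpos : 0 < K := hρ.trans_le hK
  rw [div_mul_eq_mul_div, div_le_iff₀ hDpos]
  set L := ‖(Γ.symm : Submodule.span ℂ S →L[ℂ] PiLp 1 (fun _ : ι => ℂ))‖
  calc K * Fintype.card ι ≤ K * (L * ‖∑ i, (((ε i : ℤ) : ℝ) : ℂ) • y i‖) := by gcongr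
    _ = (K * L) * ‖∑ i, (((ε i : ℤ) : ℝ) : ℂ) • y i‖ := by ring
    _ ≤ D * ‖∑ i, (((ε i : ℤ) : ℝ) : ℂ) • y i‖ := by gcongr; exact hΓD
    _ = _ := mul_comm _ _

theorem iterate_mem_partialOrbit {A : Type*} [NonUnitalCStarAlgebra A] (α : A ≃⋆ₐ[ℂ] A)
    {Ω : Set A} {n k : ℕ} (hk : k < n) {x : A}
    (hx : x ∈ Ω) : (α : A → A)^[k] x ∈ partialOrbit α Ω n :=
  Set.mem_iUnion.mpr ⟨⟨k, hk⟩, x, hx, rfl⟩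

theorem norm_iterate_starAlgEquiv {A : Type*} [NonUnitalCStarAlgebra A] (α : A ≃⋆ₐ[ℂ] A)
    (k : ℕ) (x : A) :
    ‖(α : A → A)^[k] x‖ = ‖x‖ := by
  induction k with
  | zero => rfl
  | succ k ih =>
    rw [Function.iterate_succ_apply', NonUnitalStarAlgHom.norm_map α (EquivLike.injective α), ih]

/-- The finite set `Ω` has a least nonzero norm, and the image of a basis vector is nonzero because
`Γ` is injective and `α` isometric. -/
theorem exists_norm_lower_bound {A : Type*} [NonUnitalCStarAlgebra A] {α : A ≃⋆ₐ[ℂ] A}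
    {Ω : Finset A} {D : ℝ} {I : ℕ → Finset (ℕ × A)}
    (hI : ∀ n, ∀ p ∈ I n, p.1 < n ∧ p.2 ∈ Ω)
    (hbasis : ∀ n, IsEll1Basis (I n) D {y : A | ∃ p ∈ I n, y = (α : A → A)^[p.1] p.2}) :
    ∃ ρ : ℝ, 0 < ρ ∧ ∀ n, (I n).Nonempty → ∃ p ∈ I n, ρ ≤ ‖p.2‖ := by
  obtain ⟨ρ, hρ, hle⟩ : ∃ ρ : ℝ, 0 < ρ ∧ ∀ x ∈ Ω, x ≠ 0 → ρ ≤ ‖x‖ := by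
    classical
    have h : ∀ x ∈ Ω.filter (· ≠ 0), ∀ᶠ ρ : ℝ in nhdsWithin 0 (Set.Ioi 0), ρ ≤ ‖x‖ :=
      fun x hx => by
        have : 0 < ‖x‖ := norm_pos_iff.mpr (Finset.mem_filter.mp hx).2
        exact (eventually_le_nhds this).filter_mono nhdsWithin_le_nhds
    obtain ⟨ρ, h1, h2⟩ := (((Finset.eventually_all _).mpr h).and self_mem_nhdsWithin).exists
    exact ⟨ρ, h2, fun x hx hx0 => h1 x (Finset.mem_filter.mpr ⟨hx, hx0⟩)⟩
  refine ⟨ρ, hρ, fun n ⟨p, hp⟩ => ?_⟩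
  obtain ⟨Γ, hΓ, -⟩ := hbasis n
  obtain ⟨q, hq, hqΓ⟩ := hΓ ⟨p, hp⟩
  refine ⟨q, hq, hle _ (hI n q hq).2 fun h0 => ?_⟩
  have hz := norm_iterate_starAlgEquiv α q.1 q.2
  rw [← hqΓ, h0, norm_zero, norm_eq_zero] at hz
  have hz' := Subtype.ext (a2 := (0 : Submodule.span ℂ _)) hz
  rw [map_eq_zero_iff Γ Γ.injective] at hz'
  have := congrArg norm hz'
  rw [PiLp.norm_single, norm_one, norm_zero] at this
  exact one_ne_zero this

/-! ### From the rank estimate to entropy. -/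

section Entropy

variable {A : Type u} [NonUnitalCStarAlgebra A] [PartialOrder A] [StarOrderedRing A]
variable {H : Type v} [NormedAddCommGroup H] [InnerProductSpace ℂ H] [CompleteSpace H]

/-- The rank estimate is applied to the contractions `K⁻¹ • φ (y i)`: contractivity of `ψ` and
isometry of `π` lose at most `card ι * δ` on a signed sum. -/
theorem CPA.mul_card_le_log_rank {π : A →⋆ₙₐ[ℂ] (H →L[ℂ] H)} (hπ : Function.Injective π)
    {S : Set A} {δ : ℝ} (T : CPA π S δ) {C : StarSubalgebra ℂ T.B} (hC : IsMaximalCommutative C)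
    {ι : Type*} [Fintype ι] {y : ι → A} (hyS : ∀ i, y i ∈ S) {ρ K D : ℝ} (hρ : 0 < ρ)
    (hK : ρ ≤ K) (hy : ∀ i, ‖y i‖ ≤ K) (hD : 1 ≤ D)
    (hlow : ∀ ε : ι → ℤˣ, K / D * Fintype.card ι ≤ ‖∑ i, (((ε i : ℤ) : ℝ) : ℂ) • y i‖)
    (hδ : 0 < δ) (hδρ : δ < ρ * D⁻¹) :
    Fintype.card ι * ((D ^ 2)⁻¹ * (1 - D * δ / ρ) ^ 2) / 2 ≤
      Real.log (2 * (Module.finrank ℂ C : ℝ) ^ 2) := by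
  have hDpos : 0 < D := by linarith
  have hKpos : 0 < K := hρ.trans_le hK
  have hc : 0 ≤ D⁻¹ * (1 - D * δ / ρ) := by
    refine mul_nonneg (by positivity) ?_
    rw [sub_nonneg, div_le_one hρ]
    rw [← div_eq_mul_inv, lt_div_iff₀ hDpos] at hδρ
    linarith
  have := _root_.mul_card_le_log_rank hC (x := fun i => ((K⁻¹ : ℝ) : ℂ) • T.φ (y i)) ?_ hc ?_
  · rwa [mul_pow, inv_pow] at this
  · intro i
    rw [norm_smul, Complex.norm_real, Real.norm_of_nonneg (by positivity), inv_mul_le_one₀ hKpos]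
    exact (T.φ_contractive _).trans (hy i)
  · intro ε
    set s : ι → ℂ := fun i => (((ε i : ℤ) : ℝ) : ℂ) with hs
    have hs1 : ∀ i, ‖s i‖ = 1 := fun i => by
      simp only [hs]
      rcases Int.units_eq_one_or (ε i) with h | h <;> simp [h]
    have h1 : ∑ i, s i • ((K⁻¹ : ℝ) : ℂ) • T.φ (y i) =
        ((K⁻¹ : ℝ) : ℂ) • T.φ (∑ i, s i • y i) := by
      rw [map_sum, Finset.smul_sum]
      exact Finset.sum_congr rfl fun i _ => by rw [map_smul, smul_comm]
    have h2 : ‖T.ψ (T.φ (∑ i, s i • y i)) - π (∑ i, s i • y i)‖ ≤ Fintype.card ι * δ := by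
      have : T.ψ (T.φ (∑ i, s i • y i)) - π (∑ i, s i • y i) =
          ∑ i, s i • (T.ψ (T.φ (y i)) - π (y i)) := by
        simp only [map_sum, map_smul, ← Finset.sum_sub_distrib, smul_sub]
      rw [this]
      refine (norm_sum_le _ _).trans ?_
      refine (Finset.sum_le_card_nsmul _ _ δ fun i _ => ?_).trans (by simp)
      rw [norm_smul, hs1, one_mul]
      exact (T.approx _ (hyS i)).le
    have h3 : ‖∑ i, s i • y i‖ ≤ ‖T.φ (∑ i, s i • y i)‖ + Fintype.card ι * δ := by
      rw [← NonUnitalStarAlgHom.norm_map π hπ]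
      have h4 := norm_sub_norm_le (π (∑ i, s i • y i)) (T.ψ (T.φ (∑ i, s i • y i)))
      rw [norm_sub_rev] at h4
      linarith [T.ψ_contractive (T.φ (∑ i, s i • y i))]
    change _ ≤ ‖∑ i, s i • ((K⁻¹ : ℝ) : ℂ) • T.φ (y i)‖
    rw [h1, norm_smul, Complex.norm_real, Real.norm_of_nonneg (by positivity)]
    rw [inv_mul_eq_div K, le_div_iff₀ hKpos]
    have h5 : D⁻¹ * (1 - D * δ / ρ) * Fintype.card ι * K =
        K / D * Fintype.card ι - Fintype.card ι * δ * (K / ρ) := by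
      field_simp
    -- Since `K ≥ ρ`, the relative error `δ / K` is at most `δ / ρ`, which frees the bound from `K`.
    have h6 : Fintype.card ι * δ ≤ Fintype.card ι * δ * (K / ρ) :=
      le_mul_of_one_le_right (by positivity) ((one_le_div hρ).mpr hK)
    rw [h5]
    linarith [hlow ε]

theorem le_log_rcp {π : A →⋆ₙₐ[ℂ] (H →L[ℂ] H)} (hπ : Function.Injective π) (α : A ≃⋆ₐ[ℂ] A)
    {Ω : Finset A} {D : ℝ} (hD : 1 ≤ D) {n : ℕ} {I : Finset (ℕ × A)}
    (hI : ∀ p ∈ I, p.1 < n ∧ p.2 ∈ Ω)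
    (hbasis : IsEll1Basis I D {y : A | ∃ p ∈ I, y = (α : A → A)^[p.1] p.2}) {ρ δ : ℝ}
    (hρ : 0 < ρ) (hbig : I.Nonempty → ∃ p ∈ I, ρ ≤ ‖p.2‖) (hδ : 0 < δ) (hδρ : δ < ρ * D⁻¹) :
    ((I.card * ((D ^ 2)⁻¹ * (1 - D * δ / ρ) ^ 2) / 4 - Real.log 2 / 2 : ℝ) : EReal) ≤
      ENNReal.log (rcp π (partialOrbit α (Ω : Set A) n) δ : ENNReal) := by
  classical
  set S := {y : A | ∃ p ∈ I, y = (α : A → A)^[p.1] p.2} with hS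
  set L := I.card * ((D ^ 2)⁻¹ * (1 - D * δ / ρ) ^ 2) / 4 - Real.log 2 / 2 with hL
  have hSimg : S = (fun p : ℕ × A => (α : A → A)^[p.1] p.2) '' I := by
    ext y; simp [hS, eq_comm]
  have key : ∀ (T : CPA π (partialOrbit α (Ω : Set A) n) δ) (C : StarSubalgebra ℂ T.B),
      IsMaximalCommutative C → Real.exp L ≤ Module.finrank ℂ C := by
    intro T C hC
    have hr : 0 < Module.finrank ℂ C := by
      have : FiniteDimensional ℂ C :=
        FiniteDimensional.finiteDimensional_submodule (Subalgebra.toSubmodule C.toSubalgebra)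
      exact Module.finrank_pos
    have hr' : (0 : ℝ) < Module.finrank ℂ C := Nat.cast_pos.mpr hr
    rw [← Real.le_log_iff_exp_le hr']
    have hlog : I.card * ((D ^ 2)⁻¹ * (1 - D * δ / ρ) ^ 2) / 2 ≤
        Real.log (2 * (Module.finrank ℂ C : ℝ) ^ 2) := by
      rcases I.eq_empty_or_nonempty with rfl | hne
      · simp only [Finset.card_empty, Nat.cast_zero, zero_mul, zero_div]
        refine Real.log_nonneg ?_
        have : (1 : ℝ) ≤ Module.finrank ℂ C := Nat.one_le_cast.mpr hr
        nlinarith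
      · obtain ⟨p, hp, hρp⟩ := hbig hne
        obtain ⟨y, K, hK, hyS, hy, hlow⟩ := hbasis.exists_family hρ hD
          (hSimg ▸ I.finite_toSet.image _)
          (by
            rw [hSimg, Fintype.card_coe, ← Set.ncard_coe_finset]
            exact Set.ncard_image_le I.finite_toSet)
          ⟨_, ⟨p, hp, rfl⟩, (norm_iterate_starAlgEquiv α p.1 p.2).symm ▸ hρp⟩
        have := T.mul_card_le_log_rank hπ hC (y := y) (fun i => ?_) hρ hK hy hD hlow hδ hδρ
        · rwa [Fintype.card_coe] at this
        · obtain ⟨q, hq, hqy⟩ := hyS i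
          rw [hqy]
          exact iterate_mem_partialOrbit α (hI q hq).1 (hI q hq).2
    rw [Real.log_mul two_ne_zero (by positivity), Real.log_pow] at hlog
    push_cast at hlog
    rw [hL]
    linarith
  have h1 : ((⌈Real.exp L⌉₊ : ℕ) : ℕ∞) ≤ rcp π (partialOrbit α (Ω : Set A) n) δ :=
    le_iInf fun T => le_iInf fun C => le_iInf fun hC =>
      Nat.cast_le.mpr (Nat.ceil_le.mpr (key T C hC))
  have h2 : ENNReal.ofReal (Real.exp L) ≤ (rcp π (partialOrbit α (Ω : Set A) n) δ : ENNReal) := by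
    refine le_trans ?_ (ENat.toENNReal_le.mpr h1)
    rw [ENat.toENNReal_coe, ← ENNReal.ofReal_natCast]
    exact ENNReal.ofReal_le_ofReal (Nat.le_ceil _)
  refine le_trans (le_of_eq ?_) (ENNReal.log_le_log h2)
  rw [ENNReal.log_ofReal_of_pos (Real.exp_pos _), Real.log_exp]

theorem le_htAt {π : A →⋆ₙₐ[ℂ] (H →L[ℂ] H)} (hπ : Function.Injective π) (α : A ≃⋆ₐ[ℂ] A)
    {Ω : Finset A} {D : ℝ} (hD : 1 ≤ D) {I : ℕ → Finset (ℕ × A)}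
    (hI : ∀ n, ∀ p ∈ I n, p.1 < n ∧ p.2 ∈ Ω)
    (hbasis : ∀ n, IsEll1Basis (I n) D {y : A | ∃ p ∈ I n, y = (α : A → A)^[p.1] p.2})
    {μ ρ δ : ℝ} (hμ : μ ≤ limsup (fun n : ℕ => ((I n).card : ℝ) / (n : ℝ)) atTop)
    (hρ : 0 < ρ) (hbig : ∀ n, (I n).Nonempty → ∃ p ∈ I n, ρ ≤ ‖p.2‖) (hδ : 0 < δ)
    (hδρ : δ < ρ * D⁻¹) :
    ((μ * (4 : ℝ)⁻¹ * (D ^ 2)⁻¹ * (1 - D * δ / ρ) ^ 2 : ℝ) : EReal) ≤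
      htAt π α (Ω : Set A) δ := by
  have hDpos : 0 < D := by linarith
  have hθ : 0 < 1 - D * δ / ρ := by
    rw [sub_pos, div_lt_one hρ]
    rw [← div_eq_mul_inv, lt_div_iff₀ hDpos] at hδρ
    linarith
  set q := (D ^ 2)⁻¹ * (1 - D * δ / ρ) ^ 2 / 4 with hq
  have hqpos : 0 < q := by positivity
  have hval : μ * (4 : ℝ)⁻¹ * (D ^ 2)⁻¹ * (1 - D * δ / ρ) ^ 2 = μ * q := by rw [hq]; ring
  rw [hval]
  refine le_of_forall_lt fun z hz => ?_
  obtain ⟨t, hzt, ht⟩ := EReal.lt_iff_exists_real_btwn.mp hz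
  refine hzt.trans_le ?_
  have ht' : t / q < μ := by
    rw [div_lt_iff₀ hqpos]
    exact EReal.coe_lt_coe_iff.mp ht
  obtain ⟨μ', h1, h2⟩ := exists_between ht'
  have hfreq : ∃ᶠ n : ℕ in atTop, μ' < ((I n).card : ℝ) / (n : ℝ) := by
    refine frequently_lt_of_lt_limsup ?_ (h2.trans_le hμ)
    -- The real-valued limsup needs coboundedness here; nonnegativity of the ratios supplies it.
    exact IsCoboundedUnder.of_frequently_ge (a := 0) (Frequently.of_forall fun n => by positivity)
  -- The gap between `t / q` and `μ'` absorbs the vanishing `log 2` term.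
  have hev : ∀ᶠ n : ℕ in atTop, t ≤ μ' * q - Real.log 2 / 2 / (n : ℝ) := by
    have hlim : Tendsto (fun n : ℕ => μ' * q - Real.log 2 / 2 / (n : ℝ)) atTop
        (nhds (μ' * q - 0)) :=
      tendsto_const_nhds.sub (tendsto_const_div_atTop_nhds_zero_nat _)
    rw [sub_zero] at hlim
    exact hlim.eventually_const_le ((div_lt_iff₀ hqpos).mp h1)
  refine le_limsup_of_frequently_le ?_ (by isBoundedDefault)
  refine (hfreq.and_eventually (hev.and (eventually_gt_atTop 0))).mono ?_
  rintro n ⟨h3, h4, hn⟩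
  have hn' : (0 : ℝ) < n := Nat.cast_pos.mpr hn
  have h5 := le_log_rcp hπ α hD (hI n) (hbasis n) hρ (hbig n) hδ hδρ
  have h6 : t ≤ ((I n).card * ((D ^ 2)⁻¹ * (1 - D * δ / ρ) ^ 2) / 4 - Real.log 2 / 2) / n := by
    refine h4.trans ?_
    rw [sub_div]
    gcongr
    rw [mul_div_assoc, ← hq, mul_div_right_comm]
    gcongr
  calc (t : EReal) ≤ (((I n).card * ((D ^ 2)⁻¹ * (1 - D * δ / ρ) ^ 2) / 4 -
        Real.log 2 / 2 : ℝ) : EReal) / (n : EReal) := by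
        rw [← EReal.coe_natCast, ← EReal.coe_div]
        exact EReal.coe_le_coe_iff.mpr h6
    _ ≤ _ := EReal.div_le_div_right_of_nonneg (by positivity) h5

end Entropy

theorem proposition2p2 :
    ∃ a : ℝ, 0 < a ∧
      ∀ (A : Type u) [NonUnitalCStarAlgebra A] [PartialOrder A] [StarOrderedRing A]
        (_ : IsExactCStarAlgebra A)
        (H : Type v) [NormedAddCommGroup H] [InnerProductSpace ℂ H] [CompleteSpace H]
        (π : A →⋆ₙₐ[ℂ] (H →L[ℂ] H)) (_ : Function.Injective π)
        (α : A ≃⋆ₐ[ℂ] A) (Ω : Finset A) (D : ℝ) (_ : 1 ≤ D)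
        (I : ℕ → Finset (ℕ × A))
        (_ : ∀ n, ∀ p ∈ I n, p.1 < n ∧ p.2 ∈ Ω)
        (_ : 0 < limsup (fun n : ℕ => ((I n).card : ℝ) / (n : ℝ)) atTop)
        (_ : ∀ n, IsEll1Basis (I n) D {y : A | ∃ p ∈ I n, y = (α : A → A)^[p.1] p.2}),
        0 < ht π α ∧
        ∀ (μ ρ δ : ℝ), 0 < μ →
          μ ≤ limsup (fun n : ℕ => ((I n).card : ℝ) / (n : ℝ)) atTop →
          0 < ρ → (∀ n, (I n).Nonempty → ∃ p ∈ I n, ρ ≤ ‖p.2‖) →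
          0 < δ → δ < ρ * D⁻¹ →
          ((μ * a⁻¹ * (D ^ 2)⁻¹ * (1 - D * δ / ρ) ^ 2 : ℝ) : EReal) ≤ htAt π α (Ω : Set A) δ := by
  -- One factor 2 is the `1 / 2` in the exponent of the rank estimate, the other comes from the
  -- square of the rank.
  refine ⟨4, by norm_num, ?_⟩
  intro A _ _ _ _ H _ _ _ π hπ α Ω D hD I hI hlim hbasis
  refine ⟨?_, fun μ ρ δ _ hμ hρ hbig hδ hδρ => le_htAt hπ α hD hI hbasis hμ hρ hbig hδ hδρ⟩
  obtain ⟨ρ, hρ, hbig⟩ := exists_norm_lower_bound hI hbasis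
  have hDpos : 0 < D := by linarith
  -- Half the admissible threshold makes `1 - D * δ / ρ` equal to `1 / 2`.
  have hδ : 0 < ρ * D⁻¹ / 2 := by positivity
  have h := le_htAt hπ α hD hI hbasis le_rfl hρ hbig hδ (half_lt_self (by positivity))
  have hθ : 1 - D * (ρ * D⁻¹ / 2) / ρ = 1 / 2 := by field_simp; norm_num
  rw [hθ] at h
  have hpos : (0 : EReal) < htAt π α (Ω : Set A) (ρ * D⁻¹ / 2) :=
    lt_of_lt_of_le (EReal.coe_pos.mpr (by positivity)) h
  refine hpos.trans_le ?_
  refine le_trans ?_ (le_iSup (fun Ω : Finset A => htOn π α (Ω : Set A)) Ω)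
  exact le_iSup₂ (f := fun δ (_ : 0 < δ) => htAt π α (Ω : Set A) δ) _ hδ
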